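/- Let $\mathcal H=L^2(\mathbb R)$ be the Hilbert space of complex square integrable functions on $\mathbb R$, and for $x,y\in\mathbb R$ let $e^{i(xX+yP)}$ be the unitary (Weyl) operator on $\mathcal H$ given by $$\left[e^{i(xX+yP)}f\right](z)=e^{i\left(\frac{xy}{2}+xz\right)}f(z+y)\qquad (f\in L^2(\mathbb R)),$$ where $X$ and $P=-i\,\frac{\mathrm d}{\mathrm dx}$ are the position and momentum operators. A state is a positive trace class operator $\rho$ on $\mathcal H$ with $\operatorname{tr}\rho=1$. For a state $\rho$ let $$[V(\rho)](x,y)=\frac1{\sqrt{2\pi}}\operatorname{tr}\left(\rho\, e^{i(xX+yP)}\right),\qquad (x,y)\in\mathbb R^2,$$ which is a function in $L^2(\mathbb R^2)$, and let the Wigner function of $\rho$ be $$W(\rho)=\frac1{\sqrt{2\pi}}\,\mathcal F_2V(\rho)\in L^2(\mathbb R^2),$$ where $\mathcal F_2$ is the unitary Fourier transform on $L^2(\mathbb R^2)$, given by $\mathcal F_2f(\xi)=\frac1{2\pi}\int_{\mathbb R^2}e^{-i\langle\xi,u\rangle}f(u)\,\mathrm du$ for $f\in L^1\cap L^2(\mathbb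 R^2)$. Then for every state $\rho$ the support of $W(\rho)$, i.e. the complement of the largest open set on which $W(\rho)$ vanishes almost everywhere, is an unbounded subset of $\mathbb R^2$. -/

import Mathlib

open MeasureTheory
open scoped FourierTransform

noncomputable section

namespace Homodyne

section Trace

variable {H : Type*} [NormedAddCommGroup H] [InnerProductSpace ℂ H] [CompleteSpace H]

variable (H) in
/-- The index set of a fixed orthonormal (Hilbert) basis of `H`. -/
def basisIndex : Set H := (exists_hilbertBasis ℂ H).choose

variable (H) in
/-- A fixed orthonormal (Hilbert) basis of `H`. -/
def basis : HilbertBasis (basisIndex H) ℂ H := (exists_hilbertBasis ℂ H).choose_spec.choose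

/-- `T` is of trace class: `∑ᵢ ⟨eᵢ, |T| eᵢ⟩ < ∞`, where `|T| = (T* T)^{1/2}`
(a condition that does not depend on the orthonormal basis). -/
def IsTraceClass (T : H →L[ℂ] H) : Prop :=
  Summable fun i => inner ℂ (basis H i) (CFC.abs T (basis H i))

/-- The trace `∑ᵢ ⟨eᵢ, T eᵢ⟩` of a trace class operator. The series converges absolutely for a
trace class operator and its sum does not depend on the orthonormal basis. The scalar product is
linear in the second entry. -/
def trace (T : H →L[ℂ] H) : ℂ := ∑' i, inner ℂ (basis H i) (T (basis H i))

/-- A state on `H`: a positive trace class operator of trace one. -/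
structure IsState (ρ : H →L[ℂ] H) : Prop where
  isPositive : ρ.IsPositive
  isTraceClass : IsTraceClass ρ
  trace_eq_one : trace ρ = 1

end Trace

/-- The Hilbert space `L²(ℝ)` of complex square integrable functions on the line. -/
abbrev L2R : Type := Lp ℂ 2 (volume : Measure ℝ)

/-- The Euclidean plane. -/
abbrev Plane : Type := EuclideanSpace ℝ (Fin 2)

section Weyl

/-- The function `z ↦ e^{i(xy/2 + xz)} f(z + y)`. -/
def weylFun (x y : ℝ) (f : ℝ → ℂ) : ℝ → ℂ := fun z =>
  Complex.exp (Complex.I * ((x * y / 2 + x * z : ℝ) : ℂ)) * f (z + y)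

theorem norm_weylFun (x y : ℝ) (f : ℝ → ℂ) (z : ℝ) : ‖weylFun x y f z‖ = ‖f (z + y)‖ := by
  rw [weylFun, norm_mul, mul_comm Complex.I, Complex.norm_exp_ofReal_mul_I, one_mul]

theorem aestronglyMeasurable_weylFun (x y : ℝ) {f : ℝ → ℂ}
    (hf : AEStronglyMeasurable f volume) :
    AEStronglyMeasurable (weylFun x y f) volume := by
  refine AEStronglyMeasurable.mul ?_ ?_
  · exact Continuous.aestronglyMeasurable (by fun_prop)
  · exact hf.comp_measurePreserving (measurePreserving_add_right volume y)

theorem eLpNorm_weylFun (x y : ℝ) {f : ℝ → ℂ} (hf : AEStronglyMeasurable f volume) :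
    eLpNorm (weylFun x y f) 2 volume = eLpNorm f 2 volume := by
  rw [eLpNorm_congr_norm_ae (g := f ∘ fun z => z + y)
    (Filter.Eventually.of_forall (norm_weylFun x y f))]
  exact eLpNorm_comp_measurePreserving hf (measurePreserving_add_right volume y)

theorem memLp_weylFun (x y : ℝ) {f : ℝ → ℂ} (hf : MemLp f 2 volume) :
    MemLp (weylFun x y f) 2 volume :=
  ⟨aestronglyMeasurable_weylFun x y hf.1, by rw [eLpNorm_weylFun x y hf.1]; exact hf.2⟩

theorem weylFun_congr (x y : ℝ) {f g : ℝ → ℂ} (h : f =ᵐ[volume] g) :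
    weylFun x y f =ᵐ[volume] weylFun x y g := by
  filter_upwards [(measurePreserving_add_right volume y).quasiMeasurePreserving.ae_eq_comp h]
    with z hz
  have hz' : f (z + y) = g (z + y) := hz
  simp only [weylFun, hz']

/-- The Weyl operator `e^{i(xX + yP)}` on `L²(ℝ)`, where `X` is the position operator
`(X f)(z) = z f(z)` and `P` the momentum operator `P f = -i f'`; explicitly,
`(e^{i(xX + yP)} f)(z) = e^{i(xy/2 + xz)} f(z + y)`. -/
def weyl (x y : ℝ) : L2R →L[ℂ] L2R :=
  LinearIsometry.toContinuousLinearMap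
    { toFun := fun f => (memLp_weylFun x y (Lp.memLp f)).toLp
      map_add' := fun f g => by
        rw [← MemLp.toLp_add]
        refine MemLp.toLp_congr _ _ ((weylFun_congr x y (Lp.coeFn_add f g)).trans ?_)
        refine Filter.Eventually.of_forall fun z => ?_
        simp only [weylFun, Pi.add_apply, mul_add]
      map_smul' := fun c f => by
        rw [RingHom.id_apply, ← MemLp.toLp_const_smul]
        refine MemLp.toLp_congr _ _ ((weylFun_congr x y (Lp.coeFn_smul c f)).trans ?_)
        refine Filter.Eventually.of_forall fun z => ?_
        simp only [weylFun, Pi.smul_apply, smul_eq_mul]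
        ring
      norm_map' := fun f => by
        change ‖(memLp_weylFun x y (Lp.memLp f)).toLp‖ = ‖f‖
        rw [Lp.norm_toLp, eLpNorm_weylFun x y (Lp.memLp f).1, Lp.norm_def] }

theorem coeFn_weyl (x y : ℝ) (f : L2R) :
    weyl x y f =ᵐ[volume] fun z =>
      Complex.exp (Complex.I * ((x * y / 2 + x * z : ℝ) : ℂ)) * f (z + y) :=
  (memLp_weylFun x y (Lp.memLp f)).coeFn_toLp

end Weyl

/-- The function `V(T)(x, y) = (2π)^{-1/2} tr(T e^{i(xX + yP)})` on the plane. -/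
def V (T : L2R →L[ℂ] L2R) : Plane → ℂ := fun p =>
  ((1 / Real.sqrt (2 * Real.pi) : ℝ) : ℂ) * trace (T ∘L weyl (p 0) (p 1))

theorem memLp_dilate (f : Lp ℂ 2 (volume : Measure Plane)) :
    MemLp (fun ξ : Plane => ((1 / (2 * Real.pi) : ℝ) : ℂ) * f ((1 / (2 * Real.pi)) • ξ))
      2 volume := by
  have hc : (1 / (2 * Real.pi) : ℝ) ≠ 0 := by positivity
  refine MemLp.const_mul ?_ _
  have h : MemLp (f : Plane → ℂ) 2
      (Measure.map (fun ξ : Plane => (1 / (2 * Real.pi) : ℝ) • ξ) volume) := by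
    rw [Measure.map_addHaar_smul volume hc]
    exact (Lp.memLp f).smul_measure ENNReal.ofReal_ne_top
  exact h.comp_of_map (by fun_prop)

/-- The Fourier transform on `L²` of the plane in the normalization
`(F₂ f)(ξ) = (2π)⁻¹ ∫ e^{-i⟨x, ξ⟩} f(x) dx` (for integrable `f`). Mathlib's `L²` Fourier transform
`𝓕` extends `(𝓕 f)(ξ) = ∫ e^{-2πi⟨x, ξ⟩} f(x) dx`, hence `(F₂ f)(ξ) = (2π)⁻¹ (𝓕 f)(ξ / 2π)`. -/
def fourierTwo (f : Lp ℂ 2 (volume : Measure Plane)) : Lp ℂ 2 (volume : Measure Plane) :=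
  (memLp_dilate (𝓕 f)).toLp

open Classical in
/-- The Wigner transform `W(T) = (2π)^{-1/2} F₂ V(T)` of an operator `T` of trace class, an element
of `L²` of the plane. It is well known that `V(T)` is square integrable for every such `T`; for an
operator for which this fails the value is `0` (which has empty support). -/
def wigner (T : L2R →L[ℂ] L2R) : Lp ℂ 2 (volume : Measure Plane) :=
  if h : MemLp (V T) 2 volume then
    ((1 / Real.sqrt (2 * Real.pi) : ℝ) : ℂ) • fourierTwo h.toLp
  else 0

/-- The (essential) support of an almost everywhere defined function on the plane: the complement
of the largest open set on which the function vanishes almost everywhere. -/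
def essSupport (f : Plane → ℂ) : Set Plane :=
  {p | ∀ U : Set Plane, IsOpen U → p ∈ U → ¬ ∀ᵐ q ∂(volume.restrict U), f q = 0}

end Homodyne

end

/-!
Why the support is unbounded: if the Wigner function `W` of a state `ρ` had bounded support, then
the Husimi function of `ρ`, which is the convolution of `W` with a Gaussian, would decay at infinity
almost as fast as `e^{-|α|²}`. The Husimi function is a sum of terms `|Φ(ζ)|² e^{-(Re ζ)²}` with
`Φ` entire, and it cannot decay faster than about `e^{-|α|²/2}` unless all these `Φ` vanish, by
Liouville's theorem.

In detail, with `S = √ρ`, an orthonormal basis `(eᵢ)` and `gᵢ = S eᵢ`, cyclicity of the trace gives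
`tr (ρ U) = ∑ᵢ ⟨gᵢ, U gᵢ⟩` for every bounded `U`, and `∑ᵢ ‖gᵢ‖² = 1`
(`IsState.exists_hasSum_inner`); this replaces the spectral decomposition of `ρ`. So `V ρ` is, up to
a constant, the sum of the ambiguity functions `⟨gᵢ, e^{i(xX + yP)} gᵢ⟩`. Each of these is square
integrable by Plancherel's theorem on the line, and therefore so is `V ρ`
(`memLp_of_hasSum_ambiguity`).

The integral of the ambiguity function of `f` against `e^{-(x² + y²)/4 - i(xa + yb)}` equals
`2√π e^{-a²} |Φ_f(a + ib)|²`, where `Φ_f(ζ) = ∫ conj (f z) e^{-z²/2 + ζz} dz` is a Bargmann transform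
(`integral_ambiguity_mul_gaussianWeight`). On the other hand, by Parseval's identity, the integral
of `V ρ` against this weight is an integral of the Fourier transform of `V ρ` against a Gaussian
centred at a multiple of `(a, b)`. If that Fourier transform has bounded support, the integral is
`O(e^{-(a² + b²) + C|(a, b)|})` (`exists_norm_integral_mul_gaussian_le`). As the terms of the sum
over `i` are nonnegative, each `Φ = Φ_{gᵢ}` satisfies `|Φ(ζ)|² = O(e^{-(Im ζ)² + C|ζ|})`. Then
`Φ(ζ) e^{-ζ²/4}` is entire and tends to zero at infinity, so it vanishes (`eq_zero_of_sq_norm_le`).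
The Bargmann transform being injective (`eq_zero_of_bargmann_eq_zero`), all `gᵢ` are zero, which
contradicts `∑ᵢ ‖gᵢ‖² = 1`.
-/

open MeasureTheory
open scoped FourierTransform

namespace Homodyne

/-! ### The Fourier transform on `L¹ ∩ L²` -/

section Fourier

variable {E : Type*} [NormedAddCommGroup E] [InnerProductSpace ℝ E] [FiniteDimensional ℝ E]
  [MeasurableSpace E] [BorelSpace E]

theorem integral_fourier_mul_eq {f g : E → ℂ} (hf : Integrable f) (hg : Integrable g) :
    ∫ w, 𝓕 f w * g w = ∫ v, f v * 𝓕 g v := by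
  simpa using! VectorFourier.integral_bilin_fourierIntegral_eq_flip
    (ContinuousLinearMap.mul ℂ ℂ) (μ := volume) (ν := volume) (L := innerₗ E)
    Real.continuous_fourierChar continuous_inner hf hg

theorem continuous_fourier_of_integrable {f : E → ℂ} (hf : Integrable f) : Continuous (𝓕 f) :=
  VectorFourier.fourierIntegral_continuous Real.continuous_fourierChar
    (by exact continuous_inner) hf

/-- For integrable functions in `L²`, the Fourier transform on `L²` is given by the integral: both
have the same integrals against Schwartz functions. -/
theorem coeFn_fourier_toLp {f : E → ℂ} (hf : Integrable f) (hf2 : MemLp f 2) :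
    (𝓕 hf2.toLp : Lp ℂ 2 (volume : Measure E)) =ᵐ[volume] 𝓕 f := by
  have hli : LocallyIntegrable (𝓕 hf2.toLp : Lp ℂ 2 (volume : Measure E)) volume :=
    (Lp.memLp _).locallyIntegrable (by norm_num)
  have hcont : Continuous (𝓕 f) := continuous_fourier_of_integrable hf
  refine ae_eq_of_integral_contDiff_smul_eq hli hcont.locallyIntegrable fun φ hφ hφc => ?_
  let ψ : SchwartzMap E ℂ := (hφc.comp_left (g := ((↑) : ℝ → ℂ)) rfl).toSchwartzMap
    (Complex.ofRealCLM.contDiff.comp hφ)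
  have hψ : ∀ x, ψ x = (φ x : ℂ) := fun x => rfl
  have h := congrArg (fun T => T ψ) (Lp.fourier_toTemperedDistribution_eq hf2.toLp)
  simp only [TemperedDistribution.fourier_apply, Lp.toTemperedDistribution_apply] at h
  have h1 : ∀ u : E → ℂ, ∫ x, φ x • u x = ∫ x, ψ x • u x := fun u => by
    simp only [hψ, Complex.real_smul, smul_eq_mul]
  rw [h1, h1, ← h]
  have h2 : ∫ x, (𝓕 ψ) x • (hf2.toLp : E → ℂ) x = ∫ x, (𝓕 ψ) x • f x :=
    integral_congr_ae <| by filter_upwards [hf2.coeFn_toLp] with x hx using by rw [hx]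
  rw [h2]
  simpa [SchwartzMap.fourier_coe] using integral_fourier_mul_eq (g := f) ψ.integrable hf

/-- One half of Plancherel's theorem, for the integral on `L¹`; the right side may be infinite. -/
theorem lintegral_fourier_sq_le {f : E → ℂ} (hf : Integrable f) :
    ∫⁻ w, ‖𝓕 f w‖ₑ ^ 2 ≤ ∫⁻ v, ‖f v‖ₑ ^ 2 := by
  by_cases h : ∫⁻ v, ‖f v‖ₑ ^ 2 = ⊤
  · rw [h]; exact le_top
  have hn : ∀ u : E → ℂ, eLpNorm u 2 volume = (∫⁻ v, ‖u v‖ₑ ^ 2) ^ (1 / 2 : ℝ) := fun u => by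
    rw [eLpNorm_eq_lintegral_rpow_enorm_toReal (by norm_num) (by norm_num)]
    simp
  have hf2 : MemLp f 2 := ⟨hf.1, by
    rw [hn]; exact ENNReal.rpow_lt_top_of_nonneg (by norm_num) h⟩
  have h3 : eLpNorm (𝓕 f) 2 volume = eLpNorm f 2 volume := by
    rw [← eLpNorm_congr_ae (coeFn_fourier_toLp hf hf2), ← eLpNorm_congr_ae hf2.coeFn_toLp,
      ← ENNReal.toReal_eq_toReal_iff' (Lp.eLpNorm_ne_top _) (Lp.eLpNorm_ne_top _), ← Lp.norm_def,
      ← Lp.norm_def, Lp.norm_fourier_eq]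
  rw [hn, hn] at h3
  exact ((ENNReal.rpow_left_injective (by norm_num : (1 / 2 : ℝ) ≠ 0)) h3).le

theorem ae_eq_zero_of_fourier_eq_zero {f : E → ℂ} (hf : Integrable f) (hf2 : MemLp f 2)
    (h : ∀ w, 𝓕 f w = 0) : f =ᵐ[volume] 0 := by
  have h1 : (𝓕 hf2.toLp : Lp ℂ 2 (volume : Measure E)) = 0 := by
    rw [Lp.eq_zero_iff_ae_eq_zero]
    filter_upwards [coeFn_fourier_toLp hf hf2] with w hw using by rw [hw, h w]; rfl
  have h2 : hf2.toLp = 0 := by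
    rw [← norm_eq_zero, ← Lp.norm_fourier_eq, h1, norm_zero]
  exact hf2.coeFn_toLp.symm.trans ((Lp.eq_zero_iff_ae_eq_zero).1 h2)

end Fourier

/-! ### States as countable mixtures -/

section Trace

variable {H : Type*} [NormedAddCommGroup H] [InnerProductSpace ℂ H] [CompleteSpace H]

omit [CompleteSpace H] in
/-- Parseval's identity for the squared norm. -/
theorem hasSum_norm_inner_sq {ι : Type*} (b : HilbertBasis ι ℂ H) (x : H) :
    HasSum (fun i => ‖inner ℂ (b i) x‖ ^ 2) (‖x‖ ^ 2) := by
  have h := b.hasSum_inner_mul_inner x x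
  rw [inner_self_eq_norm_sq_to_K] at h
  have h2 := Complex.hasSum_re h
  convert h2 using 1
  · ext i
    rw [← inner_conj_symm x (b i), Complex.conj_mul']
    norm_cast
  · norm_cast

/-- Cyclicity of the trace, in the form `tr (S S U) = tr (S U S)` for a selfadjoint Hilbert–Schmidt
operator `S`. -/
theorem hasSum_inner_comp_cyclic {ι : Type*} (b : HilbertBasis ι ℂ H) {S : H →L[ℂ] H}
    (hS : IsSelfAdjoint S) (hsum : Summable fun i => ‖S (b i)‖ ^ 2) (U : H →L[ℂ] H) :
    HasSum (fun i => inner ℂ (S (b i)) (U (S (b i)))) (∑' i, inner ℂ (b i) (S (S (U (b i))))) := by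
  have hadj : ∀ x y, inner ℂ (S x) y = inner ℂ x (S y) := fun x y =>
    ((ContinuousLinearMap.isSelfAdjoint_iff_isSymmetric).1 hS) x y
  set U' := ContinuousLinearMap.adjoint U with hU'
  -- The double family whose two iterated sums are the two traces.
  let F : ι × ι → ℂ := fun p => inner ℂ (S (b p.1)) (b p.2) * inner ℂ (b p.2) (S (U (b p.1)))
  have hA : Summable fun p : ι × ι => ‖inner ℂ (S (b p.1)) (b p.2)‖ ^ 2 := by
    rw [summable_prod_of_nonneg (fun _ => sq_nonneg _)]
    have h : ∀ i, HasSum (fun j => ‖inner ℂ (S (b i)) (b j)‖ ^ 2) (‖S (b i)‖ ^ 2) := fun i => by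
      simpa only [norm_inner_symm] using hasSum_norm_inner_sq b (S (b i))
    exact ⟨fun i => (h i).summable, by simpa only [(h _).tsum_eq] using hsum⟩
  have hB : Summable fun p : ι × ι => ‖inner ℂ (b p.2) (S (U (b p.1)))‖ ^ 2 := by
    rw [← (Equiv.prodComm ι ι).summable_iff]
    change Summable fun p : ι × ι => ‖inner ℂ (b p.1) (S (U (b p.2)))‖ ^ 2
    rw [summable_prod_of_nonneg (fun _ => sq_nonneg _)]
    have h : ∀ j, HasSum (fun i => ‖inner ℂ (b j) (S (U (b i)))‖ ^ 2) (‖U' (S (b j))‖ ^ 2) :=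
      fun j => by
        convert hasSum_norm_inner_sq b (U' (S (b j))) using 3 with i
        rw [← hadj, hU', ← ContinuousLinearMap.adjoint_inner_left, norm_inner_symm]
    refine ⟨fun j => (h j).summable, ?_⟩
    have : Summable fun j => ‖U' (S (b j))‖ ^ 2 := by
      refine Summable.of_nonneg_of_le (fun _ => sq_nonneg _) (fun j => ?_)
        (hsum.mul_left (‖U'‖ ^ 2))
      rw [← mul_pow]
      gcongr
      exact U'.le_opNorm _
    simpa only [Function.comp_apply, Equiv.prodComm_apply, Prod.fst_swap, Prod.snd_swap,
      (h _).tsum_eq] using this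
  have hF : Summable F := by
    refine Summable.of_norm_bounded (hA.add hB) fun p => ?_
    have hab : ∀ u v : ℂ, ‖u * v‖ ≤ ‖u‖ ^ 2 + ‖v‖ ^ 2 := fun u v => by
      rw [norm_mul]
      nlinarith [sq_nonneg (‖u‖ - ‖v‖), sq_nonneg ‖u‖, sq_nonneg ‖v‖]
    exact hab _ _
  have h1 : ∀ i, HasSum (fun j => F (i, j)) (inner ℂ (b i) (S (S (U (b i))))) := fun i => by
    have h := b.hasSum_inner_mul_inner (S (b i)) (S (U (b i)))
    rw [hadj (b i) (S (U (b i)))] at h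
    exact h
  have h2 : ∀ j, HasSum (fun i => F (i, j)) (inner ℂ (S (b j)) (U (S (b j)))) := fun j => by
    have h := b.hasSum_inner_mul_inner (U' (S (b j))) (S (b j))
    rw [hU', ContinuousLinearMap.adjoint_inner_left] at h
    have heq : ∀ i, inner ℂ (ContinuousLinearMap.adjoint U (S (b j))) (b i) *
        inner ℂ (b i) (S (b j)) = F (i, j) := fun i => by
      rw [ContinuousLinearMap.adjoint_inner_left, hadj, ← hadj (b i), mul_comm]
    simpa only [heq] using h
  have h3 := hF.hasSum.prod_fiberwise h1
  have h4 := ((Equiv.prodComm ι ι).hasSum_iff.2 hF.hasSum).prod_fiberwise h2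
  rwa [h3.tsum_eq]

/-- A state `ρ` is a countable mixture of (unnormalized) vector states: with `S = √ρ` and an
orthonormal basis `(eᵢ)`, take the nonzero vectors among the `S eᵢ`. -/
theorem IsState.exists_hasSum_inner {ρ : H →L[ℂ] H} (hρ : IsState ρ) :
    ∃ (s : Set (basisIndex H)) (g : s → H), Countable s ∧ HasSum (fun i => ‖g i‖ ^ 2) 1 ∧
      ∀ U : H →L[ℂ] H, HasSum (fun i => inner ℂ (g i) (U (g i))) (trace (ρ ∘L U)) := by
  have hpos : 0 ≤ ρ := (ContinuousLinearMap.nonneg_iff_isPositive ρ).2 hρ.isPositive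
  set S := CFC.sqrt ρ with hSdef
  have hSS : ∀ x, S (S x) = ρ x := fun x =>
    congrArg (fun T : H →L[ℂ] H => T x) (CFC.sqrt_mul_sqrt_self ρ hpos)
  have hS : IsSelfAdjoint S := (CFC.sqrt_nonneg ρ).isSelfAdjoint
  have hadj : ∀ x y, inner ℂ (S x) y = inner ℂ x (S y) := fun x y =>
    ((ContinuousLinearMap.isSelfAdjoint_iff_isSymmetric).1 hS) x y
  have hnorm : ∀ i, inner ℂ (basis H i) (ρ (basis H i)) = ((‖S (basis H i)‖ ^ 2 : ℝ) : ℂ) :=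
    fun i => by rw [← hSS, ← hadj, inner_self_eq_norm_sq_to_K]; norm_cast
  have hone : ∑' i, inner ℂ (basis H i) (ρ (basis H i)) = 1 := hρ.trace_eq_one
  -- A series that is not summable has sum `0`, so the trace being `1` forces summability.
  have hsum : Summable fun i => inner ℂ (basis H i) (ρ (basis H i)) := by
    by_contra h
    rw [tsum_eq_zero_of_not_summable h] at hone
    exact zero_ne_one hone
  have hsq : HasSum (fun i => ‖S (basis H i)‖ ^ 2) 1 := by
    have := hsum.hasSum
    rw [hone] at this
    simp only [hnorm] at this
    exact Complex.hasSum_ofReal.1 (by simpa using this)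
  refine ⟨Function.support fun i => ‖S (basis H i)‖ ^ 2, fun i => S (basis H i),
    hsq.summable.countable_support, ?_, fun U => ?_⟩
  · exact (hasSum_subtype_iff_of_support_subset subset_rfl).2 hsq
  · have h := hasSum_inner_comp_cyclic (basis H) hS hsq.summable U
    have h2 : trace (ρ ∘L U) = ∑' i, inner ℂ (basis H i) (S (S (U (basis H i)))) := by
      simp only [trace, hSS, ContinuousLinearMap.comp_apply]
    rw [h2]
    refine (hasSum_subtype_iff_of_support_subset (f := fun i =>
      inner ℂ (S (basis H i)) (U (S (basis H i)))) fun i hi => ?_).2 h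
    contrapose! hi
    have : S (basis H i) = 0 := by simpa using hi
    simp [this]

end Trace

/-! ### Ambiguity functions -/

section Ambiguity

/-- The Fourier–Wigner transform (cross-ambiguity function) of `f` with itself: the matrix
coefficient `⟨f, e^{i(xX + yP)} f⟩` of the Weyl operators, on the plane `ℝ × ℝ`. -/
noncomputable def ambiguity (f : L2R) (q : ℝ × ℝ) : ℂ := inner ℂ f (weyl q.1 q.2 f)

theorem norm_ambiguity_le (f : L2R) (q : ℝ × ℝ) : ‖ambiguity f q‖ ≤ ‖f‖ ^ 2 := by
  refine (norm_inner_le_norm _ _).trans_eq ?_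
  rw [weyl, LinearIsometry.coe_toContinuousLinearMap, LinearIsometry.norm_map, sq]

theorem ambiguity_eq_integral (f : L2R) (q : ℝ × ℝ) :
    ambiguity f q = ∫ z, starRingEnd ℂ (f z) *
      (Complex.exp (Complex.I * ((q.1 * q.2 / 2 + q.1 * z : ℝ) : ℂ)) * f (z + q.2)) := by
  rw [ambiguity, L2.inner_def]
  refine integral_congr_ae ?_
  filter_upwards [coeFn_weyl q.1 q.2 f] with z hz
  rw [hz, RCLike.inner_apply, mul_comm]

theorem stronglyMeasurable_ambiguity (f : L2R) : StronglyMeasurable (ambiguity f) := by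
  have h : StronglyMeasurable fun p : (ℝ × ℝ) × ℝ => starRingEnd ℂ (f p.2) *
      (Complex.exp (Complex.I * ((p.1.1 * p.1.2 / 2 + p.1.1 * p.2 : ℝ) : ℂ)) *
        f (p.2 + p.1.2)) := by
    have hf := Lp.stronglyMeasurable f
    refine StronglyMeasurable.mul ?_ (StronglyMeasurable.mul ?_ ?_)
    · exact Complex.continuous_conj.comp_stronglyMeasurable (hf.comp_measurable measurable_snd)
    · exact Continuous.stronglyMeasurable (by fun_prop)
    · exact hf.comp_measurable (by fun_prop)
  rw [funext (ambiguity_eq_integral f)]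
  exact h.integral_prod_right

theorem memLp_comp_add_right (f : L2R) (y : ℝ) : MemLp (fun z => f (z + y)) 2 volume :=
  (Lp.memLp f).comp_measurePreserving (measurePreserving_add_right volume y)

theorem memLp_conj (f : L2R) : MemLp (fun z => starRingEnd ℂ (f z)) 2 volume :=
  (Lp.memLp f).star

theorem integrable_conj_mul_translate (f : L2R) (y : ℝ) :
    Integrable fun z => starRingEnd ℂ (f z) * f (z + y) :=
  (memLp_conj f).integrable_mul (memLp_comp_add_right f y)

/-- For fixed `y`, the ambiguity function is up to a phase a Fourier transform in `x`. -/
theorem ambiguity_eq_fourier (f : L2R) (x y : ℝ) :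
    ambiguity f (x, y) = Complex.exp (Complex.I * ((x * y / 2 : ℝ) : ℂ)) *
      𝓕 (fun z => starRingEnd ℂ (f z) * f (z + y)) (-(2 * Real.pi)⁻¹ * x) := by
  rw [ambiguity_eq_integral, Real.fourier_eq', ← integral_const_mul]
  refine integral_congr_ae (.of_forall fun z => ?_)
  have h : Complex.exp (Complex.I * ((x * y / 2 + x * z : ℝ) : ℂ)) =
      Complex.exp (Complex.I * ((x * y / 2 : ℝ) : ℂ)) *
      Complex.exp (((-2 * Real.pi * inner ℝ z (-(2 * Real.pi)⁻¹ * x) : ℝ) : ℂ) * Complex.I) := by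
    rw [← Complex.exp_add]
    congr 1
    have hpi : Real.pi ≠ 0 := Real.pi_ne_zero
    have : -2 * Real.pi * inner ℝ z (-(2 * Real.pi)⁻¹ * x) = x * z := by
      simp only [RCLike.inner_apply, conj_trivial]
      field_simp
    rw [this]
    push_cast
    ring
  simp only [h, smul_eq_mul]
  ring

theorem lintegral_enorm_sq_eq (f : L2R) : ∫⁻ z, ‖f z‖ₑ ^ 2 = ENNReal.ofReal (‖f‖ ^ 2) := by
  have h := eLpNorm_eq_lintegral_rpow_enorm_toReal (f := (f : ℝ → ℂ)) (μ := volume) (p := 2)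
    (by norm_num) (by norm_num)
  rw [ENNReal.ofReal_pow (norm_nonneg _), Lp.norm_def, ENNReal.ofReal_toReal (Lp.eLpNorm_ne_top f),
    h, ← ENNReal.rpow_natCast, ← ENNReal.rpow_mul]
  simp

/-- The `L²` bound for ambiguity functions, by Plancherel's theorem in `x` for each fixed `y`. -/
theorem lintegral_ambiguity_sq_le (f : L2R) :
    ∫⁻ q, ‖ambiguity f q‖ₑ ^ 2 ≤
      ENNReal.ofReal (2 * Real.pi) * ENNReal.ofReal (‖f‖ ^ 2) ^ 2 := by
  have hpi := Real.pi_pos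
  have hmeas := (stronglyMeasurable_ambiguity f).measurable
  have hf := (Lp.stronglyMeasurable f).measurable
  have hslice : ∀ y, ∫⁻ x, ‖ambiguity f (x, y)‖ₑ ^ 2 ≤
      ENNReal.ofReal (2 * Real.pi) * ∫⁻ z, ‖f z‖ₑ ^ 2 * ‖f (z + y)‖ₑ ^ 2 := fun y => by
    set u : ℝ → ℂ := fun z => starRingEnd ℂ (f z) * f (z + y) with hu
    have hui : Integrable u := integrable_conj_mul_translate f y
    have h1 : ∀ x, ‖ambiguity f (x, y)‖ₑ = ‖𝓕 u (-(2 * Real.pi)⁻¹ * x)‖ₑ := fun x => by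
      rw [ambiguity_eq_fourier, enorm_mul, mul_comm Complex.I, ← ofReal_norm,
        Complex.norm_exp_ofReal_mul_I, ENNReal.ofReal_one, one_mul]
    have h2 : ∫⁻ x, ‖𝓕 u (-(2 * Real.pi)⁻¹ * x)‖ₑ ^ 2 =
        ENNReal.ofReal (2 * Real.pi) * ∫⁻ x, ‖𝓕 u x‖ₑ ^ 2 := by
      have hne : -(2 * Real.pi)⁻¹ ≠ 0 := by simp [hpi.ne']
      rw [← lintegral_map (f := fun t => ‖𝓕 u t‖ₑ ^ 2)
        (((continuous_fourier_of_integrable hui).measurable.enorm).pow_const 2) (by fun_prop),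
        Real.map_volume_mul_left hne, lintegral_smul_measure]
      congr 2
      rw [inv_neg, inv_inv, abs_neg, abs_of_pos (by positivity)]
    simp only [h1]
    rw [h2]
    refine mul_le_mul' le_rfl ?_
    refine (lintegral_fourier_sq_le hui).trans_eq (lintegral_congr fun z => ?_)
    rw [hu, enorm_mul, mul_pow, RCLike.enorm_conj]
  calc ∫⁻ q, ‖ambiguity f q‖ₑ ^ 2
      = ∫⁻ y, ∫⁻ x, ‖ambiguity f (x, y)‖ₑ ^ 2 := by
        rw [Measure.volume_eq_prod, lintegral_prod_symm' _ (by fun_prop)]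
    _ ≤ ∫⁻ y, ENNReal.ofReal (2 * Real.pi) * ∫⁻ z, ‖f z‖ₑ ^ 2 * ‖f (z + y)‖ₑ ^ 2 :=
        lintegral_mono hslice
    _ = ENNReal.ofReal (2 * Real.pi) * ∫⁻ z, ∫⁻ y, ‖f z‖ₑ ^ 2 * ‖f (z + y)‖ₑ ^ 2 := by
        rw [lintegral_const_mul' _ _ ENNReal.ofReal_ne_top, lintegral_lintegral_swap]
        fun_prop
    _ = ENNReal.ofReal (2 * Real.pi) * ENNReal.ofReal (‖f‖ ^ 2) ^ 2 := by
        have h : ∀ z, ∫⁻ y, ‖f z‖ₑ ^ 2 * ‖f (z + y)‖ₑ ^ 2 =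
            ‖f z‖ₑ ^ 2 * ENNReal.ofReal (‖f‖ ^ 2) := fun z => by
          rw [lintegral_const_mul _ (by fun_prop),
            lintegral_add_left_eq_self (fun y => ‖f y‖ₑ ^ 2), lintegral_enorm_sq_eq]
        simp only [h]
        rw [lintegral_mul_const _ (by fun_prop), lintegral_enorm_sq_eq, pow_two (ENNReal.ofReal _)]

end Ambiguity

/-! ### Gaussian weights and the Bargmann transform -/

section Bargmann

theorem memLp_gaussian (ζ : ℂ) : MemLp (fun z : ℝ => Complex.exp (-z ^ 2 / 2 + ζ * z)) 2 volume := by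
  rw [memLp_two_iff_integrable_sq_norm (Continuous.aestronglyMeasurable (by fun_prop))]
  have h := (integrable_cexp_quadratic (b := 1) (by simp) (2 * ζ) 0).norm
  refine h.congr (.of_forall fun z => ?_)
  simp only [← Complex.norm_pow, ← Complex.exp_nat_mul]
  congr 2
  push_cast
  ring

/-- The Bargmann transform of (the conjugate of) `f`, without its customary Gaussian prefactor:
the entire function `ζ ↦ ∫ conj (f z) e^{-z²/2 + ζz} dz`. -/
noncomputable def bargmann (f : L2R) (ζ : ℂ) : ℂ :=
  ∫ z : ℝ, starRingEnd ℂ (f z) * Complex.exp (-z ^ 2 / 2 + ζ * z)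

theorem integrable_bargmann (f : L2R) (ζ : ℂ) :
    Integrable fun z : ℝ => starRingEnd ℂ (f z) * Complex.exp (-z ^ 2 / 2 + ζ * z) :=
  (memLp_conj f).integrable_mul (memLp_gaussian ζ)

theorem integrable_gaussian_phase (a : ℝ) :
    Integrable fun x : ℝ => Complex.exp (-x ^ 2 / 4 - Complex.I * (x * a)) := by
  have h := integrable_cexp_quadratic (b := 1 / 4) (by norm_num) (-Complex.I * a) 0
  refine h.congr (.of_forall fun x => ?_)
  simp only
  congr 1
  ring

theorem integral_gaussian_phase (s : ℝ) :
    ∫ x : ℝ, Complex.exp (-x ^ 2 / 4 + Complex.I * (x * s)) =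
      ((2 * √Real.pi : ℝ) : ℂ) * Complex.exp (-s ^ 2) := by
  have h := fourierIntegral_gaussian (b := 1 / 4) (by norm_num) s
  have h2 : ((Real.pi : ℂ) / (1 / 4)) ^ (1 / 2 : ℂ) = ((2 * √Real.pi : ℝ) : ℂ) := by
    have h3 : (Real.pi : ℂ) / (1 / 4) = ((2 ^ 2 * Real.pi : ℝ) : ℂ) := by push_cast; ring
    rw [h3, show (1 / 2 : ℂ) = ((1 / 2 : ℝ) : ℂ) by push_cast; rfl,
      ← Complex.ofReal_cpow (by positivity), ← Real.sqrt_eq_rpow,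
      Real.sqrt_mul (by positivity), Real.sqrt_sq (by norm_num)]
  rw [h2] at h
  convert h using 1
  · refine integral_congr_ae (.of_forall fun x => ?_)
    simp only [← Complex.exp_add]
    congr 1
    ring
  · congr 2
    ring

theorem integral_ambiguity_mul_gaussian_slice (f : L2R) (a y : ℝ) :
    ∫ x : ℝ, ambiguity f (x, y) * Complex.exp (-x ^ 2 / 4 - Complex.I * (x * a)) =
      ((2 * √Real.pi : ℝ) : ℂ) * ∫ z : ℝ, starRingEnd ℂ (f z) * f (z + y) *
        Complex.exp (-(z + y / 2 - a) ^ 2) := by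
  have hint : Integrable (Function.uncurry fun x z : ℝ =>
      Complex.exp (-x ^ 2 / 4 - Complex.I * (x * a)) * (starRingEnd ℂ (f z) * f (z + y)) *
        Complex.exp (((x * y / 2 + x * z : ℝ) : ℂ) * Complex.I)) (volume.prod volume) := by
    refine ((integrable_gaussian_phase a).mul_prod (integrable_conj_mul_translate f y)).mul_bdd
      (c := 1) (Continuous.aestronglyMeasurable (by fun_prop)) (.of_forall fun q => ?_)
    rw [Complex.norm_exp_ofReal_mul_I]
  calc ∫ x : ℝ, ambiguity f (x, y) * Complex.exp (-x ^ 2 / 4 - Complex.I * (x * a))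
      = ∫ x : ℝ, ∫ z : ℝ, Complex.exp (-x ^ 2 / 4 - Complex.I * (x * a)) *
          (starRingEnd ℂ (f z) * f (z + y)) *
            Complex.exp (((x * y / 2 + x * z : ℝ) : ℂ) * Complex.I) := by
        refine integral_congr_ae (.of_forall fun x => ?_)
        simp only [ambiguity_eq_integral]
        rw [mul_comm, ← integral_const_mul]
        refine integral_congr_ae (.of_forall fun z => ?_)
        simp only [mul_comm Complex.I (Complex.ofReal _)]
        ring
    _ = ∫ z : ℝ, ∫ x : ℝ, Complex.exp (-x ^ 2 / 4 - Complex.I * (x * a)) *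
          (starRingEnd ℂ (f z) * f (z + y)) *
            Complex.exp (((x * y / 2 + x * z : ℝ) : ℂ) * Complex.I) :=
        integral_integral_swap hint
    _ = ∫ z : ℝ, ((2 * √Real.pi : ℝ) : ℂ) * (starRingEnd ℂ (f z) * f (z + y) *
          Complex.exp (-(z + y / 2 - a) ^ 2)) := by
        refine integral_congr_ae (.of_forall fun z => ?_)
        have h := integral_gaussian_phase (z + y / 2 - a)
        push_cast at h
        calc _ = ∫ x : ℝ, (starRingEnd ℂ (f z) * f (z + y)) * Complex.exp (-x ^ 2 / 4 +
                Complex.I * (x * (z + y / 2 - a))) := by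
              refine integral_congr_ae (.of_forall fun x => ?_)
              have : Complex.exp (-x ^ 2 / 4 + Complex.I * (x * (z + y / 2 - a))) =
                  Complex.exp (-x ^ 2 / 4 - Complex.I * (x * a)) *
                  Complex.exp (((x * y / 2 + x * z : ℝ) : ℂ) * Complex.I) := by
                rw [← Complex.exp_add]
                congr 1
                push_cast
                ring
              simp only [this]
              ring
          _ = _ := by
              rw [integral_const_mul, h]
              push_cast
              ring
    _ = _ := integral_const_mul _ _

/-- The Gaussian weight on the plane whose integral against the Weyl operators is a multiple
of the projection onto the coherent state centred at `(a, b)`. -/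
noncomputable def gaussianWeight (a b : ℝ) (q : ℝ × ℝ) : ℂ :=
  Complex.exp (-q.1 ^ 2 / 4 - Complex.I * (q.1 * a)) *
    Complex.exp (-q.2 ^ 2 / 4 - Complex.I * (q.2 * b))

theorem integrable_gaussianWeight (a b : ℝ) : Integrable (gaussianWeight a b) :=
  (integrable_gaussian_phase a).mul_prod (integrable_gaussian_phase b)

theorem integrable_ambiguity_mul_gaussianWeight (f : L2R) (a b : ℝ) :
    Integrable fun q => ambiguity f q * gaussianWeight a b q :=
  (integrable_gaussianWeight a b).bdd_mul (stronglyMeasurable_ambiguity f).aestronglyMeasurable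
    (.of_forall (norm_ambiguity_le f))

/-- Integrating the ambiguity function against a shifted Gaussian gives the overlap of `f` with a
coherent state. The integral is, up to a factor, the Husimi function of `f` at `(a, b)`. -/
theorem integral_ambiguity_mul_gaussianWeight (f : L2R) (a b : ℝ) :
    ∫ q, ambiguity f q * gaussianWeight a b q =
      ((2 * √Real.pi * (Real.exp (-a ^ 2) * ‖bargmann f (a + b * Complex.I)‖ ^ 2) : ℝ) : ℂ) := by
  set ζ : ℂ := a + b * Complex.I with hζ
  let G : ℝ → ℂ := fun z => starRingEnd ℂ (f z) * Complex.exp (-z ^ 2 / 2 + ζ * z)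
  have hG : Integrable G := integrable_bargmann f ζ
  have hGc : Integrable fun z => starRingEnd ℂ (G z) := Complex.conjCLE.integrable_comp_iff.2 hG
  have hprod : Integrable (Function.uncurry fun y z : ℝ => G z * starRingEnd ℂ (G (z + y)))
      (volume.prod volume) :=
    (measurePreserving_prod_add_swap volume volume).integrable_comp_of_integrable
      (hG.mul_prod hGc)
  -- The exponents combine: the weight factors over the points `z` and `z + y`.
  have hexp : ∀ y z : ℝ, starRingEnd ℂ (f z) * f (z + y) *
      Complex.exp (-(z + y / 2 - a) ^ 2) * Complex.exp (-y ^ 2 / 4 - Complex.I * (y * b)) =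
      Complex.exp (-a ^ 2) * (G z * starRingEnd ℂ (G (z + y))) := fun y z => by
    simp only [G, map_mul, Complex.conj_conj, ← Complex.exp_conj, map_add, map_neg, map_div₀,
      map_pow, Complex.conj_ofReal, hζ, Complex.conj_I, map_ofNat]
    have : Complex.exp (-(z + y / 2 - a) ^ 2) * Complex.exp (-y ^ 2 / 4 - Complex.I * (y * b)) =
        Complex.exp (-a ^ 2) * (Complex.exp (-z ^ 2 / 2 + (a + b * Complex.I) * z) *
          Complex.exp (-((z + y : ℝ) : ℂ) ^ 2 / 2 + (a + b * -Complex.I) * ((z + y : ℝ) : ℂ))) := by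
      simp only [← Complex.exp_add]
      congr 1
      push_cast
      ring
    rw [mul_assoc _ (Complex.exp _) (Complex.exp _), this]
    ring
  calc ∫ q, ambiguity f q * gaussianWeight a b q
      = ∫ y, ∫ x, ambiguity f (x, y) * gaussianWeight a b (x, y) := by
        rw [Measure.volume_eq_prod, integral_prod_symm]
        exact integrable_ambiguity_mul_gaussianWeight f a b
    _ = ∫ y, ((2 * √Real.pi : ℝ) : ℂ) * ∫ z : ℝ,
          Complex.exp (-a ^ 2) * (G z * starRingEnd ℂ (G (z + y))) := by
        refine integral_congr_ae (.of_forall fun y => ?_)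
        simp only [gaussianWeight, ← mul_assoc (ambiguity f _)]
        rw [integral_mul_const, integral_ambiguity_mul_gaussian_slice, mul_assoc,
          ← integral_mul_const]
        simp only [hexp]
    _ = ((2 * √Real.pi : ℝ) : ℂ) * (Complex.exp (-a ^ 2) *
          ∫ z, ∫ y, G z * starRingEnd ℂ (G (z + y))) := by
        rw [integral_const_mul]
        simp only [integral_const_mul (Complex.exp (-a ^ 2))]
        rw [integral_integral_swap hprod]
    _ = ((2 * √Real.pi : ℝ) : ℂ) * (Complex.exp (-a ^ 2) *
          (bargmann f ζ * starRingEnd ℂ (bargmann f ζ))) := by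
        have h : ∀ z, ∫ y, starRingEnd ℂ (G (z + y)) = starRingEnd ℂ (bargmann f ζ) := fun z => by
          rw [integral_add_left_eq_self (fun y => starRingEnd ℂ (G y)), integral_conj]
          rfl
        simp only [integral_const_mul, h]
        rw [integral_mul_const]
        rfl
    _ = _ := by
        rw [Complex.mul_conj']
        push_cast
        ring

theorem differentiable_bargmann (f : L2R) : Differentiable ℂ (bargmann f) := by
  intro ζ₀
  -- On the unit ball around `ζ₀`, the `ζ`-derivative of the integrand is at most
  -- `|f z| e^{-z²/2 + c|z|}`, and `e^{c|z|} ≤ e^{cz} + e^{-cz}`.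
  let c : ℝ := |ζ₀.re| + 2
  let bound : ℝ → ℝ := fun z => ‖starRingEnd ℂ (f z) * Complex.exp (-z ^ 2 / 2 + c * z)‖ +
    ‖starRingEnd ℂ (f z) * Complex.exp (-z ^ 2 / 2 + (-c : ℂ) * z)‖
  have hbound : Integrable bound :=
    (integrable_bargmann f c).norm.add (integrable_bargmann f (-c)).norm
  refine (hasDerivAt_integral_of_dominated_loc_of_deriv_le (μ := volume) (bound := bound)
    (F := fun ζ z => starRingEnd ℂ (f z) * Complex.exp (-(z : ℂ) ^ 2 / 2 + ζ * z))
    (F' := fun ζ z => starRingEnd ℂ (f z) * (Complex.exp (-(z : ℂ) ^ 2 / 2 + ζ * z) * z))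
    (Metric.ball_mem_nhds ζ₀ one_pos) (.of_forall fun ζ => (integrable_bargmann f ζ).1)
    (integrable_bargmann f ζ₀) ?_ (.of_forall fun z ζ hζ => ?_) hbound
    (.of_forall fun z ζ _ => ?_)).2.differentiableAt
  · exact (memLp_conj f).1.mul (Continuous.aestronglyMeasurable (by fun_prop))
  · have hre : |ζ.re| ≤ |ζ₀.re| + 1 := by
      have h1 : |(ζ - ζ₀).re| ≤ 1 :=
        (Complex.abs_re_le_norm _).trans (mem_ball_iff_norm.1 hζ).le
      rw [Complex.sub_re] at h1
      linarith [abs_sub_abs_le_abs_sub ζ.re ζ₀.re]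
    have hz : |z| ≤ Real.exp |z| := by linarith [Real.add_one_le_exp |z|]
    have hmain : Real.exp (-z ^ 2 / 2 + ζ.re * z) * |z| ≤
        Real.exp (-z ^ 2 / 2 + c * z) + Real.exp (-z ^ 2 / 2 + -c * z) := by
      have h1 : Real.exp (-z ^ 2 / 2 + ζ.re * z) * |z| ≤ Real.exp (-z ^ 2 / 2 + c * |z|) := by
        refine (mul_le_mul_of_nonneg_left hz (Real.exp_pos _).le).trans ?_
        rw [← Real.exp_add, Real.exp_le_exp]
        have : ζ.re * z ≤ (|ζ₀.re| + 1) * |z| :=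
          (le_abs_self _).trans ((abs_mul _ _).trans_le (by gcongr))
        have hc : c * |z| = (|ζ₀.re| + 1) * |z| + |z| := by simp only [c]; ring
        linarith
      rcases le_total 0 z with h | h
      · rw [abs_of_nonneg h] at h1 ⊢
        linarith [Real.exp_pos (-z ^ 2 / 2 + -c * z)]
      · rw [abs_of_nonpos h, mul_neg c, ← neg_mul c] at h1
        rw [abs_of_nonpos h]
        linarith [Real.exp_pos (-z ^ 2 / 2 + c * z)]
    have hre2 : ∀ w : ℂ, ‖Complex.exp (-(z : ℂ) ^ 2 / 2 + w * z)‖ =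
        Real.exp (-z ^ 2 / 2 + w.re * z) := fun w => by
      rw [Complex.norm_exp]
      congr 1
      have : (-(z : ℂ) ^ 2 / 2) = ((-z ^ 2 / 2 : ℝ) : ℂ) := by push_cast; ring
      rw [this, Complex.add_re, Complex.ofReal_re, Complex.re_mul_ofReal]
    simp only [bound, norm_mul, hre2, Complex.norm_real, Real.norm_eq_abs, Complex.neg_re,
      Complex.ofReal_re]
    rw [← mul_add]
    gcongr
  · have h : HasDerivAt (fun ζ : ℂ => -(z : ℂ) ^ 2 / 2 + ζ * z) (z : ℂ) ζ := by
      simpa using ((hasDerivAt_id ζ).mul_const (z : ℂ)).const_add (-(z : ℂ) ^ 2 / 2)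
    exact h.cexp.const_mul _

/-- The Bargmann transform is injective, as on the imaginary axis it is a Fourier transform. -/
theorem eq_zero_of_bargmann_eq_zero {f : L2R} (h : ∀ ζ, bargmann f ζ = 0) : f = 0 := by
  have hint := integrable_bargmann f 0
  have hL2 : MemLp (fun z : ℝ => starRingEnd ℂ (f z) * Complex.exp (-z ^ 2 / 2 + 0 * z)) 2 := by
    refine (Lp.memLp f).of_le hint.1 (.of_forall fun z => ?_)
    rw [norm_mul, RCLike.norm_conj]
    refine mul_le_of_le_one_right (norm_nonneg _) ?_
    have : (-(z : ℂ) ^ 2 / 2 + 0 * z) = ((-z ^ 2 / 2 : ℝ) : ℂ) := by push_cast; ring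
    rw [this, Complex.norm_exp_ofReal]
    exact Real.exp_le_one_iff.2 (by nlinarith [sq_nonneg z])
  have h0 := ae_eq_zero_of_fourier_eq_zero hint hL2 fun w => by
    refine Eq.trans ?_ (h (-2 * Real.pi * w * Complex.I))
    rw [Real.fourier_eq', bargmann]
    refine integral_congr_ae (.of_forall fun z => ?_)
    simp only [smul_eq_mul]
    rw [mul_left_comm, ← Complex.exp_add]
    congr 2
    simp only [RCLike.inner_apply, conj_trivial]
    push_cast
    ring
  rw [Lp.eq_zero_iff_ae_eq_zero]
  filter_upwards [h0] with z hz
  simpa [Complex.exp_ne_zero] using hz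

end Bargmann

/-! ### Mixtures of ambiguity functions -/

section Mixtures

variable {ι : Type*} [Countable ι] {g : ι → L2R} {T : ℝ × ℝ → ℂ}

/-- A summable superposition of ambiguity functions is square integrable. -/
theorem memLp_of_hasSum_ambiguity (hg : Summable fun i => ‖g i‖ ^ 2)
    (hT : ∀ q, HasSum (fun i => ambiguity (g i) q) (T q)) : MemLp T 2 volume := by
  have hmeas : ∀ i, Measurable (ambiguity (g i)) := fun i =>
    (stronglyMeasurable_ambiguity (g i)).measurable
  have hTm : AEStronglyMeasurable T volume := by
    refine aestronglyMeasurable_of_tendsto_ae (Filter.atTop : Filter (Finset ι))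
      (f := fun s q => ∑ i ∈ s, ambiguity (g i) q) (fun s => ?_) (.of_forall fun q => hT q)
    exact (Finset.measurable_sum s fun i _ => hmeas i).aestronglyMeasurable
  have hpair : ∀ i j, ∫⁻ q, ‖ambiguity (g i) q‖ₑ * ‖ambiguity (g j) q‖ₑ ≤
      ENNReal.ofReal (2 * Real.pi) *
        (ENNReal.ofReal (‖g i‖ ^ 2) * ENNReal.ofReal (‖g j‖ ^ 2)) := fun i j => by
    have hroot : ∀ i, (∫⁻ q, ‖ambiguity (g i) q‖ₑ ^ (2 : ℝ)) ^ (1 / 2 : ℝ) ≤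
        ENNReal.ofReal (2 * Real.pi) ^ (1 / 2 : ℝ) * ENNReal.ofReal (‖g i‖ ^ 2) := fun i => by
      have h := ENNReal.rpow_le_rpow (lintegral_ambiguity_sq_le (g i))
        (by norm_num : (0 : ℝ) ≤ 1 / 2)
      rw [ENNReal.mul_rpow_of_nonneg _ _ (by norm_num), ← ENNReal.rpow_natCast (ENNReal.ofReal _),
        ← ENNReal.rpow_mul] at h
      simpa using h
    refine (ENNReal.lintegral_mul_le_Lp_mul_Lq volume Real.HolderConjugate.two_two
      (hmeas i).enorm.aemeasurable (hmeas j).enorm.aemeasurable).trans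
      ((mul_le_mul' (hroot i) (hroot j)).trans_eq ?_)
    have h2 : ENNReal.ofReal (2 * Real.pi) ^ (1 / 2 : ℝ) *
        ENNReal.ofReal (2 * Real.pi) ^ (1 / 2 : ℝ) = ENNReal.ofReal (2 * Real.pi) := by
      rw [← ENNReal.rpow_add_of_nonneg _ _ (by norm_num) (by norm_num)]
      norm_num
    rw [mul_mul_mul_comm, h2]
  -- Expand the square of the sum and apply the Cauchy–Schwarz bound `hpair` to each product.
  have hsq : ∫⁻ q, ‖T q‖ₑ ^ 2 < ⊤ := by
    calc ∫⁻ q, ‖T q‖ₑ ^ 2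
        ≤ ∫⁻ q, ∑' i, ∑' j, ‖ambiguity (g i) q‖ₑ * ‖ambiguity (g j) q‖ₑ := by
          refine lintegral_mono fun q => ?_
          simp only [ENNReal.tsum_mul_left, ENNReal.tsum_mul_right]
          rw [← sq, ← (hT q).tsum_eq]
          gcongr
          exact enorm_tsum_le_tsum_enorm
      _ = ∑' i, ∑' j, ∫⁻ q, ‖ambiguity (g i) q‖ₑ * ‖ambiguity (g j) q‖ₑ := by
          rw [lintegral_tsum fun i => by fun_prop]
          refine tsum_congr fun i => ?_
          rw [lintegral_tsum fun j => by fun_prop]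
      _ ≤ ∑' i, ∑' j, ENNReal.ofReal (2 * Real.pi) *
            (ENNReal.ofReal (‖g i‖ ^ 2) * ENNReal.ofReal (‖g j‖ ^ 2)) :=
          ENNReal.tsum_le_tsum fun i => ENNReal.tsum_le_tsum fun j => hpair i j
      _ < ⊤ := by
          simp only [ENNReal.tsum_mul_left, ENNReal.tsum_mul_right]
          have h := hg.tsum_ofReal_ne_top
          finiteness
  refine ⟨hTm, ?_⟩
  rw [eLpNorm_lt_top_iff_lintegral_rpow_enorm_lt_top (by norm_num) (by norm_num)]
  simpa using hsq

/-- The Husimi function of a mixture dominates that of each of its components. -/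
theorem husimi_le_norm_integral (hg : Summable fun i => ‖g i‖ ^ 2)
    (hT : ∀ q, HasSum (fun i => ambiguity (g i) q) (T q)) (i : ι) (a b : ℝ) :
    2 * √Real.pi * (Real.exp (-a ^ 2) * ‖bargmann (g i) (a + b * Complex.I)‖ ^ 2) ≤
      ‖∫ q, T q * gaussianWeight a b q‖ := by
  have hint := fun i => integrable_ambiguity_mul_gaussianWeight (g i) a b
  have hsum : Summable fun i => ∫ q, ‖ambiguity (g i) q * gaussianWeight a b q‖ := by
    refine Summable.of_nonneg_of_le (fun i => by positivity) (fun i => ?_)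
      (hg.mul_right (∫ q, ‖gaussianWeight a b q‖))
    rw [← integral_const_mul]
    refine integral_mono (hint i).norm ((integrable_gaussianWeight a b).norm.const_mul _)
      fun q => ?_
    simp only [norm_mul]
    gcongr
    exact norm_ambiguity_le _ _
  have h := hasSum_integral_of_summable_integral_norm hint hsum
  have hT' : ∀ q, ∑' i, ambiguity (g i) q * gaussianWeight a b q = T q * gaussianWeight a b q :=
    fun q => ((hT q).mul_right _).tsum_eq
  simp only [hT', integral_ambiguity_mul_gaussianWeight] at h
  have hre := Complex.hasSum_re h
  simp only [Complex.ofReal_re] at hre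
  exact (le_hasSum hre i fun j _ => by positivity).trans
    ((le_abs_self _).trans (Complex.abs_re_le_norm _))

end Mixtures

/-! ### Gaussian integrals of functions with compactly supported Fourier transform -/

section Parseval

/-- If the Fourier transform of `v` has bounded support, then the integrals of `v` against
modulated Gaussians decay like a Gaussian of the frequency: by Parseval's identity they are the
integrals of the Fourier transform of `v` against Gaussians centred far from its support. -/
theorem exists_norm_integral_mul_gaussian_le {v : Plane → ℂ} (hv : MemLp v 2 volume) {r : ℝ}
    (hr : ∀ᵐ w, r < ‖w‖ → (𝓕 hv.toLp : Lp ℂ 2 (volume : Measure Plane)) w = 0) :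
    ∃ M C : ℝ, ∀ α : Plane,
      ‖∫ p, v p * Complex.exp (-(1 / 4) * ‖p‖ ^ 2 - Complex.I * inner ℝ α p)‖ ≤
        M * Real.exp (-‖α‖ ^ 2 + C * ‖α‖) := by
  have hpi := Real.pi_pos
  set vh : Lp ℂ 2 (volume : Measure Plane) := 𝓕 hv.toLp with hvh
  have hvi : Integrable vh := by
    have h : Integrable ((Metric.closedBall (0 : Plane) r).indicator vh) := by
      rw [integrable_indicator_iff measurableSet_closedBall]
      have : IsFiniteMeasure (volume.restrict (Metric.closedBall (0 : Plane) r)) :=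
        ⟨by simpa using measure_closedBall_lt_top (μ := volume) (x := (0 : Plane)) (r := r)⟩
      exact ((Lp.memLp vh).restrict _).integrable (by norm_num)
    refine h.congr ?_
    filter_upwards [hr] with w hw
    by_cases hw2 : w ∈ Metric.closedBall (0 : Plane) r
    · rw [Set.indicator_of_mem hw2]
    · rw [Set.indicator_of_notMem hw2, hw (by simpa using hw2)]
  refine ⟨4 * Real.pi * ∫ w, ‖vh w‖, 4 * Real.pi * r, fun α => ?_⟩
  set x : Plane := (2 * Real.pi)⁻¹ • α with hx
  let k : Plane → ℂ := fun p =>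
    Complex.exp (-(1 / 4 : ℂ) * ‖p‖ ^ 2 + 2 * Real.pi * Complex.I * inner ℝ x p)
  have hkc : Continuous k := by fun_prop
  have hkn : ∀ p, ‖k p‖ = Real.exp (-(1 / 4) * ‖p‖ ^ 2) := fun p => by
    simp only [k, Complex.norm_exp]
    congr 1
    have : -(1 / 4 : ℂ) * (‖p‖ : ℂ) ^ 2 + 2 * Real.pi * Complex.I * (inner ℝ x p : ℝ) =
        ((-(1 / 4) * ‖p‖ ^ 2 : ℝ) : ℂ) + ((2 * Real.pi * inner ℝ x p : ℝ) : ℂ) * Complex.I := by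
      push_cast
      ring
    rw [this]
    simp [-Complex.ofReal_mul]
  have hki : Integrable k := by
    simpa only [k] using GaussianFourier.integrable_cexp_neg_mul_sq_norm_add (b := 1 / 4)
      (by norm_num) (2 * Real.pi * Complex.I) x
  have hk2 : MemLp k 2 volume := by
    rw [memLp_two_iff_integrable_sq_norm hkc.aestronglyMeasurable]
    refine hki.norm.mono (by fun_prop) (.of_forall fun p => ?_)
    rw [norm_pow, norm_norm]
    refine pow_le_of_le_one (norm_nonneg _) ?_ two_ne_zero
    rw [hkn]
    exact Real.exp_le_one_iff.2 (by nlinarith [sq_nonneg ‖p‖])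
  have hkF : ∀ w, 𝓕 k w =
      ((4 * Real.pi * Real.exp (-‖α - (2 * Real.pi) • w‖ ^ 2) : ℝ) : ℂ) := fun w => by
    have h := fourier_gaussian_innerProductSpace' (b := 1 / 4) (by norm_num) x w
    have h2 : ‖α - (2 * Real.pi) • w‖ ^ 2 = 4 * Real.pi ^ 2 * ‖x - w‖ ^ 2 := by
      have : α - (2 * Real.pi) • w = (2 * Real.pi) • (x - w) := by
        rw [hx, smul_sub, smul_inv_smul₀ (by positivity)]
      rw [this, norm_smul, mul_pow, Real.norm_eq_abs, sq_abs]
      ring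
    rw [h, h2, finrank_euclideanSpace_fin]
    push_cast
    rw [div_self two_ne_zero, Complex.cpow_one]
    congr 1
    · ring
    · congr 1
      ring
  have hparseval : ∫ p, v p * Complex.exp (-(1 / 4) * ‖p‖ ^ 2 - Complex.I * inner ℝ α p) =
      ∫ w, vh w * ((4 * Real.pi * Real.exp (-‖α - (2 * Real.pi) • w‖ ^ 2) : ℝ) : ℂ) := by
    have h := Lp.inner_fourier_eq hk2.toLp hv.toLp
    rw [L2.inner_def, L2.inner_def] at h
    refine Eq.trans ?_ (h.symm.trans ?_)
    · refine integral_congr_ae ?_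
      filter_upwards [hk2.coeFn_toLp, hv.coeFn_toLp] with p h1 h2
      rw [h1, h2, RCLike.inner_apply]
      simp only [k, ← Complex.exp_conj, map_add, map_mul, map_neg, map_div₀, map_pow, map_one,
        map_ofNat, Complex.conj_ofReal, Complex.conj_I]
      congr 2
      rw [hx, inner_smul_left]
      simp only [conj_trivial]
      push_cast
      have : (Real.pi : ℂ) ≠ 0 := by exact_mod_cast hpi.ne'
      field_simp
      ring
    · refine integral_congr_ae ?_
      filter_upwards [coeFn_fourier_toLp hki hk2] with w h1
      rw [h1, hkF, RCLike.inner_apply, Complex.conj_ofReal]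
  rw [hparseval]
  calc _ ≤ ∫ w, (4 * Real.pi * Real.exp (-‖α‖ ^ 2 + 4 * Real.pi * r * ‖α‖)) * ‖vh w‖ := by
        refine norm_integral_le_of_norm_le (hvi.norm.const_mul _) ?_
        filter_upwards [hr] with w hw
        by_cases hw0 : vh w = 0
        · simp [hw0]
        have hwr : ‖w‖ ≤ r := by
          by_contra! hlt
          exact hw0 (hw hlt)
        rw [norm_mul, mul_comm, Complex.norm_real, Real.norm_of_nonneg (by positivity)]
        gcongr
        have h1 : ‖α‖ - 2 * Real.pi * ‖w‖ ≤ ‖α - (2 * Real.pi) • w‖ := by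
          have := norm_sub_norm_le α ((2 * Real.pi) • w)
          rwa [norm_smul, Real.norm_of_nonneg (by positivity)] at this
        have h2 : ‖α - (2 * Real.pi) • w‖ ^ 2 =
            ‖α‖ ^ 2 - 4 * Real.pi * inner ℝ α w + ‖(2 * Real.pi) • w‖ ^ 2 := by
          rw [norm_sub_sq_real, inner_smul_right]
          ring
        have h3 : inner ℝ α w ≤ ‖α‖ * r :=
          (real_inner_le_norm α w).trans (by gcongr)
        nlinarith [sq_nonneg ‖(2 * Real.pi) • w‖]
    _ = _ := by
        rw [integral_const_mul]
        ring

end Parseval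

/-! ### Bounded essential support -/

section Support

theorem measurePreserving_coords :
    MeasurePreserving (fun p : Plane => (p 0, p 1)) volume volume :=
  (volume_preserving_finTwoArrow ℝ).comp
    (EuclideanSpace.volume_preserving_symm_measurableEquiv_toLp (Fin 2))

theorem integral_coords (F : ℝ × ℝ → ℂ) : ∫ p : Plane, F (p 0, p 1) = ∫ q, F q :=
  measurePreserving_coords.integral_comp ((MeasurableEquiv.toLp 2 (Fin 2 → ℝ)).symm.trans
    MeasurableEquiv.finTwoArrow).measurableEmbedding F

/-- A function with bounded essential support vanishes almost everywhere far out: the complement of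
the support is a union of open sets where the function vanishes almost everywhere, and countably
many of them suffice. -/
theorem exists_ae_eq_zero_of_isBounded_essSupport {f : Plane → ℂ}
    (hf : Bornology.IsBounded (essSupport f)) : ∃ R : ℝ, ∀ᵐ p, R < ‖p‖ → f p = 0 := by
  obtain ⟨R, hR⟩ := hf.subset_closedBall 0
  refine ⟨R, ?_⟩
  rw [ae_iff]
  refine measure_null_of_locally_null _ fun p hp => ?_
  simp only [Set.mem_ofPred_eq, Classical.not_imp] at hp
  have hp2 : p ∉ essSupport f := fun h => by
    have := hR h
    rw [mem_closedBall_zero_iff] at this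
    linarith [hp.1]
  simp only [essSupport, Set.mem_ofPred_eq, not_forall, not_not] at hp2
  obtain ⟨U, hU, hpU, hae⟩ := hp2
  refine ⟨{q | R < ‖q‖ → f q = 0}ᶜ ∩ U, ?_, ?_⟩
  · exact Filter.inter_mem self_mem_nhdsWithin (mem_nhdsWithin_of_mem_nhds (hU.mem_nhds hpU))
  · rw [ae_restrict_iff' hU.measurableSet] at hae
    refine measure_mono_null (fun q hq => ?_) (ae_iff.1 hae)
    intro h
    exact hq.1 fun _ => h hq.2

/-- If the Wigner function vanishes far out, so does the Fourier transform of `V`. -/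
theorem exists_fourier_ae_eq_zero {T : L2R →L[ℂ] L2R} (hV : MemLp (V T) 2 volume)
    (hT : Bornology.IsBounded (essSupport (wigner T))) :
    ∃ r : ℝ, ∀ᵐ w, r < ‖w‖ → (𝓕 hV.toLp : Lp ℂ 2 (volume : Measure Plane)) w = 0 := by
  have hpi := Real.pi_pos
  obtain ⟨R, hR⟩ := exists_ae_eq_zero_of_isBounded_essSupport hT
  rw [wigner, dif_pos hV] at hR
  have h : ∀ᵐ ξ, R < ‖ξ‖ →
      (𝓕 hV.toLp : Lp ℂ 2 (volume : Measure Plane)) ((1 / (2 * Real.pi)) • ξ) = 0 := by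
    filter_upwards [hR, Lp.coeFn_smul ((1 / √(2 * Real.pi) : ℝ) : ℂ) (fourierTwo hV.toLp),
      (memLp_dilate (𝓕 hV.toLp)).coeFn_toLp] with ξ h1 h2 h3 hξ
    have h4 := h1 hξ
    rw [h2, Pi.smul_apply, fourierTwo, h3, smul_eq_mul] at h4
    have hc1 : ((1 / √(2 * Real.pi) : ℝ) : ℂ) ≠ 0 := by
      rw [Complex.ofReal_ne_zero]
      positivity
    have hc2 : ((1 / (2 * Real.pi) : ℝ) : ℂ) ≠ 0 := by
      rw [Complex.ofReal_ne_zero]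
      positivity
    exact (mul_eq_zero.1 ((mul_eq_zero.1 h4).resolve_left hc1)).resolve_left hc2
  refine ⟨R / (2 * Real.pi), ?_⟩
  have hq : Measure.QuasiMeasurePreserving (fun w : Plane => (2 * Real.pi) • w) volume volume :=
    ⟨by fun_prop, by
      rw [Measure.map_addHaar_smul volume (by positivity : (2 * Real.pi) ≠ 0)]
      exact Measure.smul_absolutelyContinuous⟩
  filter_upwards [hq.ae h] with w hw hrw
  rw [smul_smul, one_div_mul_cancel (by positivity), one_smul, norm_smul,
    Real.norm_of_nonneg (by positivity)] at hw
  exact hw (by rwa [div_lt_iff₀' (by positivity)] at hrw)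

end Support

/-! ### A Liouville theorem and unboundedness of the support -/

section Liouville

/-- An entire function whose squared modulus is at most a multiple of `e^{-b² + C|ζ|}`, `b = Im ζ`,
vanishes: multiplied by `e^{-ζ²/4}` it tends to zero at infinity. -/
theorem eq_zero_of_sq_norm_le {F : ℂ → ℂ} (hF : Differentiable ℂ F) {M C : ℝ}
    (h : ∀ ζ : ℂ, ‖F ζ‖ ^ 2 ≤ M * Real.exp (-ζ.im ^ 2 + C * ‖ζ‖)) (ζ : ℂ) : F ζ = 0 := by
  let G : ℂ → ℂ := fun ζ => F ζ * Complex.exp (-ζ ^ 2 / 4)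
  have hG : Differentiable ℂ G := by fun_prop
  have hle : ∀ ζ, ‖G ζ‖ ^ 2 ≤ M * Real.exp (-(‖ζ‖ * (‖ζ‖ / 2 - C))) := fun ζ => by
    have h1 : ‖Complex.exp (-ζ ^ 2 / 4)‖ ^ 2 = Real.exp (-(ζ.re ^ 2 - ζ.im ^ 2) / 2) := by
      rw [← norm_pow, ← Complex.exp_nat_mul, Complex.norm_exp]
      congr 1
      have : ((2 : ℕ) : ℂ) * (-ζ ^ 2 / 4) = ((-1 / 2 : ℝ) : ℂ) * (ζ * ζ) := by
        push_cast
        ring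
      rw [this, Complex.re_ofReal_mul, Complex.mul_re]
      ring
    have h2 : ‖ζ‖ ^ 2 = ζ.re ^ 2 + ζ.im ^ 2 := by
      rw [← Complex.normSq_eq_norm_sq, Complex.normSq_apply]
      ring
    rw [norm_mul, mul_pow, h1]
    refine (mul_le_mul_of_nonneg_right (h ζ) (Real.exp_pos _).le).trans_eq ?_
    rw [mul_assoc, ← Real.exp_add]
    congr 2
    linear_combination (1 / 2 : ℝ) * h2
  have hlim : Filter.Tendsto (fun t : ℝ => M * Real.exp (-(t * (t / 2 - C)))) Filter.atTop
      (nhds 0) := by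
    have h1 : Filter.Tendsto (fun t : ℝ => t * (t / 2 - C)) Filter.atTop Filter.atTop :=
      Filter.tendsto_id.atTop_mul_atTop₀ (Filter.tendsto_atTop_add_const_right _ (-C)
        (Filter.tendsto_id.atTop_div_const two_pos))
    simpa using (Real.tendsto_exp_neg_atTop_nhds_zero.comp h1).const_mul M
  have hsq : Filter.Tendsto (fun ζ => ‖G ζ‖ ^ 2) (Filter.cocompact ℂ) (nhds 0) :=
    squeeze_zero (fun _ => sq_nonneg _) hle (hlim.comp (tendsto_norm_cocompact_atTop))
  have hG0 : Filter.Tendsto G (Filter.cocompact ℂ) (nhds 0) := by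
    rw [tendsto_zero_iff_norm_tendsto_zero]
    simpa [Real.sqrt_sq] using hsq.sqrt
  have := hG.apply_eq_of_tendsto_cocompact ζ hG0
  simpa [G, Complex.exp_ne_zero] using this

theorem IsState.not_isBounded_essSupport_wigner {ρ : L2R →L[ℂ] L2R} (hρ : IsState ρ) :
    ¬ Bornology.IsBounded (essSupport (wigner ρ)) := by
  intro hb
  obtain ⟨s, g, hs, hsum, htr⟩ := hρ.exists_hasSum_inner
  let T : ℝ × ℝ → ℂ := fun q => trace (ρ ∘L weyl q.1 q.2)
  have hT : ∀ q, HasSum (fun i => ambiguity (g i) q) (T q) := fun q => htr (weyl q.1 q.2)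
  set c : ℝ := 1 / √(2 * Real.pi) with hc
  have hc0 : 0 < c := by positivity
  have hV : MemLp (V ρ) 2 volume :=
    ((memLp_of_hasSum_ambiguity hsum.summable hT).comp_measurePreserving
      measurePreserving_coords).const_mul (c : ℂ)
  obtain ⟨r, hr⟩ := exists_fourier_ae_eq_zero hV hb
  obtain ⟨M, C, hM⟩ := exists_norm_integral_mul_gaussian_le hV hr
  have hweight : ∀ a b : ℝ, c * ‖∫ q, T q * gaussianWeight a b q‖ ≤
      M * Real.exp (-(a ^ 2 + b ^ 2) + C * √(a ^ 2 + b ^ 2)) := fun a b => by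
    have hnorm : ‖(!₂[a, b] : Plane)‖ = √(a ^ 2 + b ^ 2) := by
      simp [EuclideanSpace.norm_eq, Fin.sum_univ_two]
    have h := hM !₂[a, b]
    rw [hnorm, Real.sq_sqrt (by positivity)] at h
    refine le_of_eq_of_le ?_ h
    rw [← Real.norm_of_nonneg hc0.le, ← Complex.norm_real, ← norm_mul, ← integral_const_mul,
      ← integral_coords]
    congr 1
    refine integral_congr_ae (.of_forall fun p => ?_)
    simp only [V, gaussianWeight, T, ← Complex.exp_add, Fin.sum_univ_two, PiLp.inner_apply, ← hc]
    rw [mul_assoc]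
    congr 3
    have : ((‖p‖ : ℝ) : ℂ) ^ 2 = (p 0 : ℂ) ^ 2 + (p 1 : ℂ) ^ 2 := by
      rw [← Complex.ofReal_pow, EuclideanSpace.real_norm_sq_eq, Fin.sum_univ_two]
      push_cast
      rfl
    rw [this]
    simp
    ring
  have hzero : ∀ i, g i = 0 := fun i => by
    refine eq_zero_of_bargmann_eq_zero (eq_zero_of_sq_norm_le (differentiable_bargmann (g i))
      (M := M / (c * (2 * √Real.pi))) (C := C) fun ζ => ?_)
    have h := (mul_le_mul_of_nonneg_left (husimi_le_norm_integral hsum.summable hT i ζ.re ζ.im)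
      hc0.le).trans (hweight ζ.re ζ.im)
    have hn : √(ζ.re ^ 2 + ζ.im ^ 2) = ‖ζ‖ := by
      rw [Complex.norm_eq_sqrt_sq_add_sq]
    rw [Complex.re_add_im, hn] at h
    have hexp : Real.exp (-(ζ.re ^ 2 + ζ.im ^ 2) + C * ‖ζ‖) =
        Real.exp (-ζ.re ^ 2) * Real.exp (-ζ.im ^ 2 + C * ‖ζ‖) := by
      rw [← Real.exp_add]
      congr 1
      ring
    rw [hexp] at h
    rw [div_mul_eq_mul_div, le_div_iff₀ (by positivity)]
    refine le_of_mul_le_mul_left ?_ (Real.exp_pos (-ζ.re ^ 2))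
    linarith
  simp only [hzero, norm_zero] at hsum
  norm_num at hsum
  exact zero_ne_one (hasSum_zero.unique hsum)

end Liouville

end Homodyne

theorem corollary4p2 (ρ : Homodyne.L2R →L[ℂ] Homodyne.L2R) (hρ : Homodyne.IsState ρ) :
    ¬ Bornology.IsBounded (Homodyne.essSupport (Homodyne.wigner ρ)) :=
  hρ.not_isBounded_essSupport_wigner
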